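/- Let $(X,d_X)$ be a locally compact separable metric space and $\mu$ a Borel measure on $X$ with $0<\mu(B(x,r))<\infty$ for every $x\in X$ and $r>0$. Let $\mathcal{M}$ be the set of all finite non-negative Borel measures $\nu$ on $X$ with compact support and $\nu\le\mu$, and write $\|\nu\|=\nu(X)$. Let $h:[0,\infty)\to[0,\infty)$ be a strictly increasing continuous function with $h(0)=\lim_{\varepsilon\to0^+}h(\varepsilon)/\varepsilon=0$, $h(\varepsilon_1)+h(\varepsilon_2)\le h(\varepsilon_1+\varepsilon_2)$ for all $\varepsilon_1,\varepsilon_2\ge0$, and $\lim_{\varepsilon\to\infty}h(\varepsilon)=\infty$. For $\nu,\eta\in\mathcal{M}$ let $d_{\mathcal{M}}(\nu,\eta)$ be the infimum of all $\varepsilon>0$ for which there are an at most countable index set $I$ and measures $\nu_i,\eta_i\in\mathcal{M}$ $(i\in I)$ such that $$\nu=\sum_{i\in I}\nu_i,\qquad \eta=\sum_{i\in I}\eta_i,\qquad \sum_{i\in I}\bigl|\|\nu_i\|-\|\eta_i\|\bigr|\le h(\varepsilon),$$ $$\operatorname{diam}\bigl(\operatorname{supp}(\nu_i)\cup\operatorname{supp}(\eta_i)\bigr)\le\varepsilon\quad\text{for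 every } i\in I.$$ For $b\ge0$ let $\widetilde{\mathcal{R}}_b(\mathcal{M})$ be the set of all rectifiable curves subparametrized by arc-length on $[0,b]$, that is, of all maps $\eta:[0,b]\to\mathcal{M}$ of finite $d_{\mathcal{M}}$-length with $d_{\mathcal{M}}(\eta(s'),\eta(s))\le s'-s$ for all $0\le s\le s'\le b$. Suppose that $\mathbb{M}$ is an at most countable set, $b\ge 0$, $\eta\in\widetilde{\mathcal{R}}_b(\mathcal{M})$, $t\in[0,b]$, and $\gamma_i\in\mathcal{M}$ $(i\in\mathbb{M})$ satisfy $\eta(t)=\sum_{i\in\mathbb{M}}\gamma_i$. Then there are curves $\eta_i\in\widetilde{\mathcal{R}}_b(\mathcal{M})$ $(i\in\mathbb{M})$ such that 1. $\eta_i(t)=\gamma_i$ for every $i\in\mathbb{M}$, and 2. $\eta(s)=\sum_{i\in\mathbb{M}}\eta_i(s)$ for every $s\in[0,b]$. -/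

import Mathlib

open MeasureTheory Set Filter Topology
open scoped NNReal ENNReal

namespace SubMeas

/-- The standing assumptions on a gauge `h : [0, ∞) → [0, ∞)`: it is strictly increasing and
continuous, `h 0 = 0`, `h ε / ε → 0` as `ε → 0+`, it is superadditive, and `h ε → ∞` as
`ε → ∞`. -/
structure IsGauge (h : ℝ≥0 → ℝ≥0) : Prop where
  strictMono : StrictMono h
  continuous : Continuous h
  map_zero : h 0 = 0
  tendsto_div : Tendsto (fun ε : ℝ≥0 => h ε / ε) (𝓝[>] 0) (𝓝 0)
  superadditive : ∀ a b : ℝ≥0, h a + h b ≤ h (a + b)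
  tendsto_atTop : Tendsto h atTop atTop

section Measures

variable {X : Type*} [MetricSpace X] [MeasurableSpace X]

/-- The set of all finite measures on `X` with compact support. -/
def compactlySupported (X : Type*) [MetricSpace X] [MeasurableSpace X] : Set (Measure X) :=
  {ν | IsFiniteMeasure ν ∧ IsCompact ν.support}

/-- The set of all finite measures `ν` with compact support and `0 ≤ ν ≤ μ`. -/
def dominated (μ : Measure X) : Set (Measure X) :=
  {ν | ν ∈ compactlySupported X ∧ ν ≤ μ}

/-- The total mass of a finite measure. -/
noncomputable def mass (ν : Measure X) : ℝ := ν.real univ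

/-- `IsDecomp μ ε δ ν η νs ηs` says that the (countable) family of pairs `(νs i, ηs i)` belongs
to `Γ_{ε,δ}(ν, η)`. -/
structure IsDecomp (μ : Measure X) (ε δ : ℝ≥0) (ν η : dominated μ) {M : Type*}
    (νs ηs : M → dominated μ) : Prop where
  sum_left : (ν : Measure X) = Measure.sum fun i => (νs i : Measure X)
  sum_right : (η : Measure X) = Measure.sum fun i => (ηs i : Measure X)
  mass_le : ∑' i, ENNReal.ofReal |mass (νs i : Measure X) - mass (ηs i : Measure X)| ≤ (δ : ℝ≥0∞)
  diam_le : ∀ i, Metric.ediam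
    ((νs i : Measure X).support ∪ (ηs i : Measure X).support) ≤ (ε : ℝ≥0∞)

/-- `Γ_{ε,δ}(ν, η)` is non-empty. Every countable index set has a copy in `Type`. -/
def HasDecomp (μ : Measure X) (ε δ : ℝ≥0) (ν η : dominated μ) : Prop :=
  ∃ (M : Type) (_ : Countable M) (νs ηs : M → dominated μ), IsDecomp μ ε δ ν η νs ηs

/-- The distance on `dominated μ`: the infimum of all `ε > 0` for which `Γ_{ε,h(ε)}(ν, η)` is
non-empty. The infimum is taken in `[0, ∞]`. -/
noncomputable def dominatedDist (μ : Measure X) (h : ℝ≥0 → ℝ≥0) (ν η : dominated μ) : ℝ≥0∞ :=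
  ⨅ (ε : ℝ≥0) (_ : 0 < ε ∧ HasDecomp μ ε (h ε) ν η), (ε : ℝ≥0∞)

end Measures

section Curves

variable {Y : Type*}

/-- The length of a map `γ : [a, b] → Y` with respect to the distance `d`. -/
noncomputable def curveLength (d : Y → Y → ℝ≥0∞) {a b : ℝ} (γ : Icc a b → Y) : ℝ≥0∞ :=
  ⨆ (k : ℕ) (u : {u : ℕ → Icc a b // Monotone u}),
    ∑ i ∈ Finset.range (k + 1), d (γ (u.1 (i + 1))) (γ (u.1 i))

/-- Rectifiable curves `[a, b] → Y` subparametrized by arc-length: maps of finite length that are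
`1`-Lipschitz. -/
structure IsSubparamCurve (d : Y → Y → ℝ≥0∞) {a b : ℝ} (γ : Icc a b → Y) : Prop where
  rectifiable : curveLength d γ < ∞
  lipschitz : ∀ s t : Icc a b, s ≤ t → d (γ t) (γ s) ≤ ENNReal.ofReal ((t : ℝ) - (s : ℝ))

end Curves

end SubMeas

/-!
Closeness of `ν` and `η` means that, after discarding a small mass, `ν` can be cut into countably
many pieces which are matched with pieces of `η` of equal mass lying nearby. A decomposition
`ν = ∑ᵢ γᵢ` is carried along such a matching: refine the pieces by the `γᵢ` (through densities),
split each partner in the same proportions, and add the discarded part of `η` to a single index.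
Matchings compose, with distances and discarded masses adding up. As `h(ε)/ε → 0`, subdividing the
time interval finely shows that along a curve the discarded mass can be made arbitrarily small at
no cost in distance; in particular the total mass is constant.

For finitely many times the splitting of the curve is built outwards from `t`: a new time farthest
from `t` has a neighbour lying between it and all earlier times, so that the splitting carried over
from this neighbour is almost `1`-Lipschitz against all of them. Letting the finite sets of times
exhaust the interval and the errors tend to zero along an ultrafilter, the parts, being dominated
by the curve, converge setwise, and setwise convergence below a finite measure makes measures
close. The limiting parts sum to at most the curve by Fatou, and to exactly the curve because each
part keeps its mass.
-/

namespace SubMeas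

section Decompositions

variable {X : Type*} [MeasurableSpace X]

theorem exists_common_refinement {I J : Type*} [Countable I] {ν : Measure X} [SigmaFinite ν]
    {α : I → Measure X} {β : J → Measure X} (hα : ν = Measure.sum α) (hβ : ν = Measure.sum β) :
    ∃ ρ : I → J → Measure X, (∀ i, α i = Measure.sum (ρ i)) ∧
      ∀ j, β j = Measure.sum fun i => ρ i j := by
  have hαν : ∀ i, α i ≤ ν := fun i => hα ▸ Measure.le_sum α i
  have hβν : ∀ j, β j ≤ ν := fun j => hβ ▸ Measure.le_sum β j
  have : ∀ i, SigmaFinite (α i) := fun i => Measure.sigmaFinite_of_le ν (hαν i)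
  have hdensity : ∀ i, ν.withDensity ((α i).rnDeriv ν) = α i := fun i =>
    Measure.withDensity_rnDeriv_eq _ _ (hαν i).absolutelyContinuous
  have hmeas : ∀ i, Measurable ((α i).rnDeriv ν) := fun i => Measure.measurable_rnDeriv _ _
  have hmeas_tsum : Measurable (∑' i, (α i).rnDeriv ν) := by
    have hpointwise : ∑' i, (α i).rnDeriv ν = fun x => ∑' i, (α i).rnDeriv ν x :=
      funext fun x => tsum_apply (Pi.summable.2 fun _ => ENNReal.summable)
    rw [hpointwise]
    exact Measurable.tsum hmeas
  have hpartition : (∑' i, (α i).rnDeriv ν) =ᵐ[ν] 1 := by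
    rw [← withDensity_eq_iff_of_sigmaFinite hmeas_tsum.aemeasurable (g := 1) aemeasurable_const,
      withDensity_one, withDensity_tsum hmeas]
    simp_rw [hdensity]
    exact hα.symm
  refine ⟨fun i j => (β j).withDensity ((α i).rnDeriv ν), fun i => ?_, fun j => ?_⟩
  · rw [← withDensity_sum, ← hβ, hdensity]
  · rw [← withDensity_tsum hmeas,
      withDensity_congr_ae ((hβν j).absolutelyContinuous.ae_eq hpartition), withDensity_one]

theorem exists_sum_add_refinement {I : Type*} [Countable I] {α β : Measure X} {γ : I → Measure X}
    [SigmaFinite (Measure.sum γ)] (h : Measure.sum γ = α + β) :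
    ∃ γ₁ γ₂ : I → Measure X, (∀ i, γ i = γ₁ i + γ₂ i) ∧
      α = Measure.sum γ₁ ∧ β = Measure.sum γ₂ := by
  obtain ⟨ρ, hγ, hαβ⟩ := exists_common_refinement rfl (h.trans (Measure.sum_cond α β).symm)
  exact ⟨(ρ · true), (ρ · false), fun i => (hγ i).trans (Measure.sum_bool _), hαβ true, hαβ false⟩

theorem exists_add_add_refinement {α β γ δ : Measure X} [SigmaFinite (α + β)]
    (h : α + β = γ + δ) :
    ∃ a b c d : Measure X, α = a + b ∧ β = c + d ∧ γ = a + c ∧ δ = b + d := by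
  rw [← Measure.sum_cond α β] at h
  have : SigmaFinite (Measure.sum fun i => cond i α β) := by rwa [Measure.sum_cond]
  obtain ⟨ρ, τ, hαβ, rfl, rfl⟩ := exists_sum_add_refinement h
  exact ⟨ρ true, τ true, ρ false, τ false, hαβ true, hαβ false, Measure.sum_bool _,
    Measure.sum_bool _⟩

theorem exists_sum_eq_of_measure_univ_eq {Y I : Type*} [MeasurableSpace Y] {α : Measure X}
    [IsFiniteMeasure α] {β : Measure Y} (h : α univ = β univ) {ρ : I → Measure X}
    (hρ : α = Measure.sum ρ) :
    ∃ σ : I → Measure Y, β = Measure.sum σ ∧ ∀ i, σ i univ = ρ i univ := by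
  have htsum : ∑' i, ρ i univ = α univ := by
    conv_rhs => rw [hρ, Measure.sum_apply _ MeasurableSet.univ]
  rcases eq_or_ne (α univ) 0 with h0 | h0
  · refine ⟨fun _ => 0, ?_, fun i => ?_⟩
    · rw [Measure.sum_zero, ← Measure.measure_univ_eq_zero, ← h, h0]
    · rw [ENNReal.tsum_eq_zero.1 (htsum.trans h0) i, Measure.coe_zero, Pi.zero_apply]
  · refine ⟨fun i => (ρ i univ / α univ) • β, ?_, fun i => ?_⟩
    · ext s hs
      simp only [Measure.sum_apply _ hs, Measure.smul_apply, smul_eq_mul, div_eq_mul_inv,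
        ENNReal.tsum_mul_right, htsum]
      rw [ENNReal.mul_inv_cancel h0 (measure_ne_top α univ), one_mul]
    · rw [Measure.smul_apply, smul_eq_mul, ← h,
        ENNReal.div_mul_cancel h0 (measure_ne_top α univ)]

theorem exists_add_eq_of_measure_univ_le {Y : Type*} [MeasurableSpace Y] (ν : Measure X)
    (η : Measure Y) [IsFiniteMeasure η] (h : ν univ ≤ η univ) :
    ∃ η₁ η₂ : Measure Y, η = η₁ + η₂ ∧ η₁ univ = ν univ ∧ η₂ univ = η univ - ν univ := by
  have hmass : ν univ / η univ * η univ = ν univ :=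
    ENNReal.div_mul_cancel' (fun h0 => le_antisymm (h0 ▸ h) zero_le)
      fun htop => absurd htop (measure_ne_top η univ)
  refine ⟨(ν univ / η univ) • η, (1 - ν univ / η univ) • η, ?_, hmass, ?_⟩
  · rw [← add_smul, add_tsub_cancel_of_le (ENNReal.div_le_of_le_mul (by rwa [one_mul])), one_smul]
  · rw [Measure.smul_apply, smul_eq_mul, ENNReal.sub_mul fun _ _ => measure_ne_top η univ, one_mul,
      hmass]

theorem exists_equal_mass_parts {Y : Type*} [MeasurableSpace Y] (ν : Measure X) (η : Measure Y)
    [IsFiniteMeasure ν] [IsFiniteMeasure η] :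
    ∃ (ν₁ ν₂ : Measure X) (η₁ η₂ : Measure Y), ν = ν₁ + ν₂ ∧ η = η₁ + η₂ ∧ ν₁ univ = η₁ univ ∧
      ν₂ univ = ν univ - η univ ∧ η₂ univ = η univ - ν univ := by
  rcases le_total (ν univ) (η univ) with hle | hle
  · obtain ⟨η₁, η₂, hη, hη₁, hη₂⟩ := exists_add_eq_of_measure_univ_le ν η hle
    exact ⟨ν, 0, η₁, η₂, (add_zero ν).symm, hη, hη₁.symm, (tsub_eq_zero_of_le hle).symm, hη₂⟩
  · obtain ⟨ν₁, ν₂, hν, hν₁, hν₂⟩ := exists_add_eq_of_measure_univ_le η ν hle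
    exact ⟨ν₁, ν₂, η, 0, hν, (add_zero η).symm, hν₁, hν₂, (tsub_eq_zero_of_le hle).symm⟩

theorem sum_sumElim {I J : Type*} (α : I → Measure X) (β : J → Measure X) :
    Measure.sum (Sum.elim α β) = Measure.sum α + Measure.sum β := by
  ext s hs
  simp only [Measure.add_apply, Measure.sum_apply _ hs]
  exact Summable.tsum_sum ENNReal.summable ENNReal.summable

theorem sum_piSingle {I : Type*} [DecidableEq I] (i : I) (α : Measure X) :
    Measure.sum (Pi.single i α) = α := by
  ext s hs
  rw [Measure.sum_apply _ hs, tsum_eq_single i fun j hj => by simp [Pi.single_eq_of_ne hj],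
    Pi.single_eq_same]

end Decompositions

section Transport

variable {X : Type*} [PseudoEMetricSpace X] [MeasurableSpace X]

/-- `ν` can be rearranged into `η` by moving mass over distances at most `ε`: both measures have
countable decompositions into parts of equal mass, corresponding parts lying together in a set of
diameter at most `ε`. -/
def Transportable (ε : ℝ≥0∞) (ν η : Measure X) : Prop :=
  ∃ (J : Type) (_ : Countable J) (νs ηs : J → Measure X),
    ν = Measure.sum νs ∧ η = Measure.sum ηs ∧ (∀ j, νs j univ = ηs j univ) ∧
    ∀ j, Metric.ediam ((νs j).support ∪ (ηs j).support) ≤ ε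

namespace Transportable

variable {ε ε' : ℝ≥0∞} {ν η θ : Measure X}

theorem mono (h : Transportable ε ν η) (hε : ε ≤ ε') : Transportable ε' ν η := by
  obtain ⟨J, hJ, νs, ηs, hν, hη, hmass, hdiam⟩ := h
  exact ⟨J, hJ, νs, ηs, hν, hη, hmass, fun j => (hdiam j).trans hε⟩

theorem symm (h : Transportable ε ν η) : Transportable ε η ν := by
  obtain ⟨J, hJ, νs, ηs, hν, hη, hmass, hdiam⟩ := h
  exact ⟨J, hJ, ηs, νs, hη, hν, fun j => (hmass j).symm, fun j => by
    rw [union_comm]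
    exact hdiam j⟩

theorem measure_univ_eq (h : Transportable ε ν η) : ν univ = η univ := by
  obtain ⟨J, -, νs, ηs, rfl, rfl, hmass, -⟩ := h
  rw [Measure.sum_apply _ MeasurableSet.univ, Measure.sum_apply _ MeasurableSet.univ]
  exact tsum_congr hmass

theorem exists_split {I : Type*} [Countable I] [IsFiniteMeasure ν] (h : Transportable ε ν η)
    {γ : I → Measure X} (hγ : ν = Measure.sum γ) :
    ∃ γ' : I → Measure X, η = Measure.sum γ' ∧ ∀ i, Transportable ε (γ i) (γ' i) := by
  obtain ⟨J, hJ, νs, ηs, hν, hη, hmass, hdiam⟩ := h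
  obtain ⟨ρ, hγρ, hνρ⟩ := exists_common_refinement hγ hν
  have : ∀ j, IsFiniteMeasure (νs j) := fun j =>
    isFiniteMeasure_of_le ν (hν ▸ Measure.le_sum νs j)
  choose σ hησ hσρ using fun j => exists_sum_eq_of_measure_univ_eq (hmass j) (hνρ j)
  refine ⟨fun i => Measure.sum fun j => σ j i, ?_, fun i =>
    ⟨J, hJ, ρ i, fun j => σ j i, hγρ i, rfl, fun j => (hσρ j i).symm, fun j => ?_⟩⟩
  · rw [Measure.sum_comm, hη]
    exact congrArg Measure.sum (funext hησ)
  · have hρ : ρ i j ≤ νs j := hνρ j ▸ Measure.le_sum (fun i => ρ i j) i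
    have hσ : σ j i ≤ ηs j := hησ j ▸ Measure.le_sum (σ j) i
    exact (Metric.ediam_mono (union_subset_union (Measure.support_mono hρ)
      (Measure.support_mono hσ))).trans (hdiam j)

theorem exists_add_split {ν₁ ν₂ : Measure X} [IsFiniteMeasure (ν₁ + ν₂)]
    (h : Transportable ε (ν₁ + ν₂) η) :
    ∃ η₁ η₂, η = η₁ + η₂ ∧ Transportable ε ν₁ η₁ ∧ Transportable ε ν₂ η₂ := by
  obtain ⟨ηs, hη, hηs⟩ := h.exists_split (Measure.sum_cond ν₁ ν₂).symm
  exact ⟨ηs true, ηs false, hη.trans (Measure.sum_bool ηs), hηs true, hηs false⟩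

end Transportable

theorem ediam_support_union_le [HereditarilyLindelofSpace X] {ε₁ ε₂ : ℝ≥0∞}
    {ν η η' θ ζ : Measure X} (hζ : ζ ≠ 0) (hη : ζ ≤ η) (hη' : ζ ≤ η')
    (h₁ : Metric.ediam (ν.support ∪ η.support) ≤ ε₁)
    (h₂ : Metric.ediam (η'.support ∪ θ.support) ≤ ε₂) :
    Metric.ediam (ν.support ∪ θ.support) ≤ ε₁ + ε₂ := by
  obtain ⟨x, hx⟩ := Measure.nonempty_support hζ
  have hinter : ((ν.support ∪ η.support) ∩ (η'.support ∪ θ.support)).Nonempty :=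
    ⟨x, Or.inr (Measure.support_mono hη hx), Or.inl (Measure.support_mono hη' hx)⟩
  calc Metric.ediam (ν.support ∪ θ.support)
      ≤ Metric.ediam ((ν.support ∪ η.support) ∪ (η'.support ∪ θ.support)) :=
        Metric.ediam_mono (union_subset_union subset_union_left subset_union_right)
    _ ≤ ε₁ + ε₂ := (Metric.ediam_union_le hinter).trans (add_le_add h₁ h₂)

theorem Transportable.trans [HereditarilyLindelofSpace X] {ε₁ ε₂ : ℝ≥0∞} {ν η θ : Measure X}
    [IsFiniteMeasure η] (h₁ : Transportable ε₁ ν η) (h₂ : Transportable ε₂ η θ) :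
    Transportable (ε₁ + ε₂) ν θ := by
  obtain ⟨J, hJ, νs, ηs, hν, hη, hmass, hdiam⟩ := h₁
  obtain ⟨K, hK, ηs', θs, hη', hθ, hmass', hdiam'⟩ := h₂
  obtain ⟨ρ, hρ, hρ'⟩ := exists_common_refinement hη hη'
  have : ∀ j, IsFiniteMeasure (ηs j) := fun j =>
    isFiniteMeasure_of_le η (hη ▸ Measure.le_sum ηs j)
  have : ∀ k, IsFiniteMeasure (ηs' k) := fun k =>
    isFiniteMeasure_of_le η (hη' ▸ Measure.le_sum ηs' k)
  choose σ hσ hσρ using fun j => exists_sum_eq_of_measure_univ_eq (hmass j).symm (hρ j)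
  choose τ hτ hτρ using fun k => exists_sum_eq_of_measure_univ_eq (hmass' k) (hρ' k)
  refine ⟨J × K, inferInstance, fun p => σ p.1 p.2, fun p => τ p.2 p.1, ?_, ?_,
    fun p => (hσρ _ _).trans (hτρ _ _).symm, fun ⟨j, k⟩ => ?_⟩
  · rw [hν, ← Measure.sum_sum σ]
    exact congrArg Measure.sum (funext hσ)
  · rw [hθ, ← Measure.sum_sum fun j k => τ k j, ← Measure.sum_comm τ]
    exact congrArg Measure.sum (funext hτ)
  · rcases eq_or_ne (ρ j k) 0 with h0 | h0
    · have hσ0 : σ j k = 0 := Measure.measure_univ_eq_zero.1 (by rw [hσρ, h0]; rfl)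
      have hτ0 : τ k j = 0 := Measure.measure_univ_eq_zero.1 (by rw [hτρ, h0]; rfl)
      simp [hσ0, hτ0]
    · have hσν : σ j k ≤ νs j := hσ j ▸ Measure.le_sum (σ j) k
      have hτθ : τ k j ≤ θs k := hτ k ▸ Measure.le_sum (τ k) j
      exact (Metric.ediam_mono (union_subset_union (Measure.support_mono hσν)
        (Measure.support_mono hτθ))).trans (ediam_support_union_le h0
          (hρ j ▸ Measure.le_sum (ρ j) k) (hρ' k ▸ Measure.le_sum (fun j => ρ j k) j)
          (hdiam j) (hdiam' k))

/-- Approximate form of `Transportable`: after discarding parts of `ν` and `η` of total mass at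
most `δ`, the rest of `ν` can be rearranged into the rest of `η`. -/
def AlmostTransportable (ε δ : ℝ≥0∞) (ν η : Measure X) : Prop :=
  ∃ ν₁ ν₂ η₁ η₂ : Measure X, ν = ν₁ + ν₂ ∧ η = η₁ + η₂ ∧ Transportable ε ν₁ η₁ ∧
    ν₂ univ + η₂ univ ≤ δ

namespace AlmostTransportable

variable {ε ε' δ δ' : ℝ≥0∞} {ν η θ : Measure X}

theorem mono (h : AlmostTransportable ε δ ν η) (hε : ε ≤ ε') (hδ : δ ≤ δ') :
    AlmostTransportable ε' δ' ν η := by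
  obtain ⟨ν₁, ν₂, η₁, η₂, hν, hη, htransport, hdefect⟩ := h
  exact ⟨ν₁, ν₂, η₁, η₂, hν, hη, htransport.mono hε, hdefect.trans hδ⟩

theorem symm (h : AlmostTransportable ε δ ν η) : AlmostTransportable ε δ η ν := by
  obtain ⟨ν₁, ν₂, η₁, η₂, hν, hη, htransport, hdefect⟩ := h
  exact ⟨η₁, η₂, ν₁, ν₂, hη, hν, htransport.symm, by rwa [add_comm]⟩

theorem measure_univ_le (h : AlmostTransportable ε δ ν η) : ν univ ≤ η univ + δ := by
  obtain ⟨ν₁, ν₂, η₁, η₂, rfl, rfl, htransport, hdefect⟩ := h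
  rw [Measure.add_apply, Measure.add_apply, htransport.measure_univ_eq]
  exact add_le_add le_self_add (le_self_add.trans hdefect)

theorem of_sum {J : Type} [Countable J] {νs ηs : J → Measure X} [∀ j, IsFiniteMeasure (νs j)]
    [∀ j, IsFiniteMeasure (ηs j)]
    (hdiam : ∀ j, Metric.ediam ((νs j).support ∪ (ηs j).support) ≤ ε)
    (hdefect : ∑' j, ((νs j univ - ηs j univ) + (ηs j univ - νs j univ)) ≤ δ) :
    AlmostTransportable ε δ (Measure.sum νs) (Measure.sum ηs) := by
  choose ν₁ ν₂ η₁ η₂ hν hη hmass hν₂ hη₂ using fun j => exists_equal_mass_parts (νs j) (ηs j)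
  refine ⟨Measure.sum ν₁, Measure.sum ν₂, Measure.sum η₁, Measure.sum η₂, ?_, ?_,
    ⟨J, inferInstance, ν₁, η₁, rfl, rfl, hmass, fun j => ?_⟩, ?_⟩
  · rw [Measure.sum_add_sum]
    exact congrArg Measure.sum (funext hν)
  · rw [Measure.sum_add_sum]
    exact congrArg Measure.sum (funext hη)
  · refine (Metric.ediam_mono (union_subset_union (Measure.support_mono ?_)
      (Measure.support_mono ?_))).trans (hdiam j)
    · exact (Measure.le_add_right le_rfl).trans_eq (hν j).symm
    · exact (Measure.le_add_right le_rfl).trans_eq (hη j).symm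
  · simpa only [Measure.sum_apply _ MeasurableSet.univ, hν₂, hη₂, ENNReal.tsum_add] using hdefect

theorem exists_split {I : Type*} [Countable I] [Nonempty I] [IsFiniteMeasure ν]
    (h : AlmostTransportable ε δ ν η) {γ : I → Measure X} (hγ : ν = Measure.sum γ) :
    ∃ γ' : I → Measure X, η = Measure.sum γ' ∧ ∀ i, AlmostTransportable ε δ (γ i) (γ' i) := by
  classical
  obtain ⟨ν₁, ν₂, η₁, η₂, hν, rfl, htransport, hdefect⟩ := h
  have : IsFiniteMeasure (Measure.sum γ) := hγ ▸ inferInstance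
  have : IsFiniteMeasure ν₁ := isFiniteMeasure_of_le ν (hν ▸ Measure.le_add_right le_rfl)
  obtain ⟨γ₁, γ₂, hsplit, hν₁, hν₂⟩ := exists_sum_add_refinement (hγ.symm.trans hν)
  obtain ⟨γ₁', hη₁, hγ₁'⟩ := htransport.exists_split hν₁
  obtain ⟨i₀⟩ := ‹Nonempty I›
  let γ₂' : I → Measure X := Pi.single i₀ η₂
  refine ⟨fun i => γ₁' i + γ₂' i, ?_, fun i =>
    ⟨γ₁ i, γ₂ i, γ₁' i, γ₂' i, hsplit i, rfl, hγ₁' i, le_trans ?_ hdefect⟩⟩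
  · rw [← Measure.sum_add_sum, sum_piSingle, hη₁]
  · gcongr
    · exact hν₂ ▸ Measure.le_sum γ₂ i
    · rcases eq_or_ne i i₀ with rfl | hi
      · simp only [γ₂', Pi.single_eq_same, le_refl]
      · simp only [γ₂', Pi.single_eq_of_ne hi]
        exact Measure.zero_le η₂

theorem trans [HereditarilyLindelofSpace X] [IsFiniteMeasure η] (h : AlmostTransportable ε δ ν η)
    (h' : AlmostTransportable ε' δ' η θ) : AlmostTransportable (ε + ε') (δ + δ') ν θ := by
  obtain ⟨ν₁, ν₂, η₁, η₂, rfl, hη, htransport, hdefect⟩ := h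
  obtain ⟨η₁', η₂', θ₁, θ₂, hη', rfl, htransport', hdefect'⟩ := h'
  have : IsFiniteMeasure (η₁ + η₂) := hη ▸ inferInstance
  have : IsFiniteMeasure (η₁' + η₂') := hη' ▸ inferInstance
  obtain ⟨a, b, c, d, rfl, rfl, rfl, rfl⟩ := exists_add_add_refinement (hη.symm.trans hη')
  have : IsFiniteMeasure (a + b) :=
    isFiniteMeasure_of_le (a + b + (c + d)) (Measure.le_add_right le_rfl)
  have : IsFiniteMeasure (a + c) :=
    isFiniteMeasure_of_le (a + c + (b + d)) (Measure.le_add_right le_rfl)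
  have : IsFiniteMeasure a := isFiniteMeasure_of_le (a + b) (Measure.le_add_right le_rfl)
  obtain ⟨νa, νb, rfl, hνa, hνb⟩ := htransport.symm.exists_add_split
  obtain ⟨θa, θc, rfl, hθa, hθc⟩ := htransport'.exists_add_split
  refine ⟨νa, νb + ν₂, θa, θc + θ₂, add_assoc _ _ _, add_assoc _ _ _, hνa.symm.trans hθa, ?_⟩
  calc (νb + ν₂) univ + (θc + θ₂) univ
      = ν₂ univ + c univ + (b univ + θ₂ univ) := by
        rw [Measure.add_apply, Measure.add_apply, ← hνb.measure_univ_eq, ← hθc.measure_univ_eq]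
        ring
    _ ≤ ν₂ univ + (c + d) univ + ((b + d) univ + θ₂ univ) := by
        gcongr
        · exact Measure.le_add_right le_rfl
        · exact Measure.le_add_right le_rfl
    _ ≤ δ + δ' := add_le_add hdefect hdefect'

theorem chain [HereditarilyLindelofSpace X] {u : ℕ → Measure X} [∀ n, IsFiniteMeasure (u n)]
    (hu : ∀ n, AlmostTransportable ε δ (u n) (u (n + 1))) (n : ℕ) :
    AlmostTransportable ((n + 1) * ε) ((n + 1) * δ) (u 0) (u (n + 1)) := by
  induction n with
  | zero => simpa only [Nat.cast_zero, zero_add, one_mul] using hu 0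
  | succ n ih => simpa only [Nat.cast_add_one, add_one_mul] using ih.trans (hu (n + 1))

end AlmostTransportable

end Transport

section SetwiseConvergence

theorem tendsto_ennreal_tsum_of_dominated {J K : Type*} {l : Filter K} {f : K → J → ℝ≥0∞}
    {g bound : J → ℝ≥0∞} (hbound : ∑' j, bound j ≠ ∞)
    (hlim : ∀ j, Tendsto (fun k => f k j) l (𝓝 (g j))) (hle : ∀ᶠ k in l, ∀ j, f k j ≤ bound j) :
    Tendsto (fun k => ∑' j, f k j) l (𝓝 (∑' j, g j)) := by
  rcases l.eq_or_neBot with rfl | hl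
  · exact tendsto_bot
  have hbound_ne : ∀ j, bound j ≠ ∞ := ENNReal.ne_top_of_tsum_ne_top hbound
  have hg : ∀ j, g j ≤ bound j := fun j =>
    le_of_tendsto (hlim j) (hle.mono fun k hk => hk j)
  have hg_ne : ∀ j, g j ≠ ∞ := fun j => ne_top_of_le_ne_top (hbound_ne j) (hg j)
  have hreal : Tendsto (fun k => ∑' j, (f k j).toReal) l (𝓝 (∑' j, (g j).toReal)) := by
    refine tendsto_tsum_of_dominated_convergence (ENNReal.summable_toReal hbound)
      (fun j => (ENNReal.tendsto_toReal (hg_ne j)).comp (hlim j)) (hle.mono fun k hk j => ?_)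
    rw [Real.norm_of_nonneg ENNReal.toReal_nonneg]
    exact ENNReal.toReal_mono (hbound_ne j) (hk j)
  have hg_sum : ∑' j, g j ≠ ∞ := ne_top_of_le_ne_top hbound (ENNReal.tsum_le_tsum hg)
  rw [← ENNReal.tsum_toReal_eq hg_ne] at hreal
  rw [← ENNReal.ofReal_toReal hg_sum]
  refine (ENNReal.tendsto_ofReal hreal).congr' (hle.mono fun k hk => ?_)
  rw [← ENNReal.tsum_toReal_eq fun j => ne_top_of_le_ne_top (hbound_ne j) (hk j),
    ENNReal.ofReal_toReal (ne_top_of_le_ne_top hbound (ENNReal.tsum_le_tsum hk))]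

variable {X K : Type*} [MeasurableSpace X] {l : Filter K} {ν : K → Measure X} {α β κ : Measure X}

/-- Convergence of a family of measures on every measurable set. -/
def TendstoSetwise (ν : K → Measure X) (l : Filter K) (α : Measure X) : Prop :=
  ∀ ⦃A : Set X⦄, MeasurableSet A → Tendsto (fun k => ν k A) l (𝓝 (α A))

theorem TendstoSetwise.const (α : Measure X) (l : Filter K) : TendstoSetwise (fun _ => α) l α :=
  fun _ _ => tendsto_const_nhds

theorem TendstoSetwise.unique [NeBot l] (hα : TendstoSetwise ν l α) (hβ : TendstoSetwise ν l β) :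
    α = β :=
  Measure.ext fun _ hA => tendsto_nhds_unique (hα hA) (hβ hA)

theorem TendstoSetwise.le_of_eventually_le [NeBot l] (hα : TendstoSetwise ν l α)
    (hle : ∀ᶠ k in l, ν k ≤ κ) : α ≤ κ :=
  Measure.le_iff.2 fun A hA => le_of_tendsto (hα hA) (hle.mono fun _ hk => hk A)

theorem sum_le_of_tendstoSetwise {I : Type*} [NeBot l] {σ : K → I → Measure X}
    {τ : I → Measure X} (hτ : ∀ i, TendstoSetwise (fun k => σ k i) l (τ i))
    (hle : ∀ᶠ k in l, Measure.sum (σ k) ≤ κ) : Measure.sum τ ≤ κ := by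
  refine Measure.le_iff.2 fun A hA => ?_
  rw [Measure.sum_apply _ hA]
  refine ENNReal.summable.tsum_le_of_sum_le fun s =>
    le_of_tendsto (tendsto_finsetSum s fun i _ => hτ i hA) (hle.mono fun k hk => ?_)
  calc ∑ i ∈ s, σ k i A ≤ ∑' i, σ k i A := ENNReal.sum_le_tsum s
    _ = Measure.sum (σ k) A := (Measure.sum_apply _ hA).symm
    _ ≤ κ A := hk A

theorem exists_tendstoSetwise (U : Ultrafilter K) [IsFiniteMeasure κ]
    (hle : ∀ᶠ k in (U : Filter K), ν k ≤ κ) : ∃ α, TendstoSetwise ν U α := by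
  have hlim : ∀ A : Set X, ∃ c, Tendsto (fun k => ν k A) U (𝓝 c) := fun A => by
    obtain ⟨c, -, hc⟩ := isCompact_univ.ultrafilter_le_nhds (U.map fun k => ν k A) (by simp)
    exact ⟨c, hc⟩
  choose m hm using hlim
  have hempty : m ∅ = 0 :=
    tendsto_nhds_unique (hm ∅) (by simpa only [measure_empty] using tendsto_const_nhds)
  have hiUnion : ∀ ⦃f : ℕ → Set X⦄, (∀ n, MeasurableSet (f n)) →
      Pairwise (Function.onFun Disjoint f) → m (⋃ n, f n) = ∑' n, m (f n) := by
    intro f hf hdisj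
    refine tendsto_nhds_unique (hm _) ?_
    simp_rw [measure_iUnion hdisj hf]
    refine tendsto_ennreal_tsum_of_dominated (bound := fun n => κ (f n)) ?_ (fun n => hm (f n))
      (hle.mono fun k hk n => hk (f n))
    rw [← measure_iUnion hdisj hf]
    exact measure_ne_top κ _
  refine ⟨Measure.ofMeasurable (fun A _ => m A) hempty fun f hf => hiUnion hf, fun A hA => ?_⟩
  rw [Measure.ofMeasurable_apply A hA]
  exact hm A

end SetwiseConvergence

section Closeness

theorem sum_restrict_partition {X ι : Type*} [Countable ι] [MeasurableSpace X] {A : ι → Set X}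
    (hA : ∀ n, MeasurableSet (A n)) (hcover : ⋃ n, A n = univ)
    (hdisj : Pairwise (Function.onFun Disjoint A)) (ν : Measure X) :
    Measure.sum (fun n => ν.restrict (A n)) = ν := by
  rw [← Measure.restrict_iUnion hdisj hA, hcover, Measure.restrict_univ]

theorem ediam_support_restrict_union_le {X : Type*} [PseudoEMetricSpace X] [MeasurableSpace X]
    [OpensMeasurableSpace X] {ε : ℝ≥0∞} {A : Set X} (hA : Metric.ediam (closure A) ≤ ε)
    (ν η : Measure X) :
    Metric.ediam ((ν.restrict A).support ∪ (η.restrict A).support) ≤ ε :=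
  (Metric.ediam_mono (union_subset (Measure.support_restrict_subset.trans inter_subset_left)
    (Measure.support_restrict_subset.trans inter_subset_left))).trans hA

variable {X : Type*} [PseudoMetricSpace X] [MeasurableSpace X] [OpensMeasurableSpace X]
  [TopologicalSpace.SeparableSpace X] {ε δ : ℝ≥0∞}

variable (X) in
theorem exists_measurable_partition_ediam_closure_le (hε : 0 < ε) :
    ∃ A : ℕ → Set X, (∀ n, MeasurableSet (A n)) ∧ (∀ n, Metric.ediam (closure (A n)) ≤ ε) ∧
      ⋃ n, A n = univ ∧ Pairwise (Function.onFun Disjoint A) := by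
  obtain ⟨r, hr, hrε⟩ := ENNReal.lt_iff_exists_nnreal_btwn.1 hε
  obtain ⟨A, hA, hbounded, hdiam, hcover, hdisj⟩ :=
    SeparableSpace.exists_measurable_partition_diam_le X (NNReal.coe_pos.2 (ENNReal.coe_pos.1 hr))
  refine ⟨A, hA, fun n => ?_, hcover, hdisj⟩
  calc Metric.ediam (closure (A n)) = Metric.ediam (A n) := Metric.ediam_closure _
    _ = ENNReal.ofReal (Metric.diam (A n)) :=
      (ENNReal.ofReal_toReal (Metric.isBounded_iff_ediam_ne_top.1 (hbounded n))).symm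
    _ ≤ ENNReal.ofReal r := ENNReal.ofReal_le_ofReal (hdiam n)
    _ = r := ENNReal.ofReal_coe_nnreal
    _ ≤ ε := hrε.le

theorem TendstoSetwise.eventually_almostTransportable {K : Type*} {l : Filter K} [NeBot l]
    {ν : K → Measure X} {α κ : Measure X} [IsFiniteMeasure κ] (hlim : TendstoSetwise ν l α)
    (hle : ∀ᶠ k in l, ν k ≤ κ) (hε : 0 < ε) (hδ : 0 < δ) :
    ∀ᶠ k in l, AlmostTransportable ε δ α (ν k) := by
  obtain ⟨A, hA, hdiam, hcover, hdisj⟩ := exists_measurable_partition_ediam_closure_le X hε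
  have hα : α ≤ κ := hlim.le_of_eventually_le hle
  have : IsFiniteMeasure α := isFiniteMeasure_of_le κ hα
  have hbound : ∑' n, (κ (A n) + κ (A n)) ≠ ∞ := by
    rw [ENNReal.tsum_add, ← measure_iUnion hdisj hA]
    finiteness
  have hdefect : Tendsto (fun k => ∑' n, ((α (A n) - ν k (A n)) + (ν k (A n) - α (A n)))) l
      (𝓝 0) := by
    rw [← tsum_zero (α := ℝ≥0∞) (β := ℕ)]
    refine tendsto_ennreal_tsum_of_dominated hbound (fun n => ?_) (hle.mono fun k hk n =>
      add_le_add (tsub_le_self.trans (hα _)) (tsub_le_self.trans (hk _)))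
    have hne : α (A n) ≠ ∞ := measure_ne_top α _
    have hconst : Tendsto (fun _ => α (A n)) l (𝓝 (α (A n))) := tendsto_const_nhds
    have hloss := ENNReal.Tendsto.sub hconst (hlim (hA n)) (Or.inl hne)
    have hgain := ENNReal.Tendsto.sub (hlim (hA n)) hconst (Or.inl hne)
    simpa only [tsub_self, add_zero] using hloss.add hgain
  filter_upwards [hle, hdefect.eventually_le_const hδ] with k hk hk_defect
  have : IsFiniteMeasure (ν k) := isFiniteMeasure_of_le κ hk
  rw [← sum_restrict_partition hA hcover hdisj α, ← sum_restrict_partition hA hcover hdisj (ν k)]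
  refine AlmostTransportable.of_sum (fun n => ediam_support_restrict_union_le (hdiam n) _ _) ?_
  simpa only [Measure.restrict_apply_univ] using hk_defect

theorem AlmostTransportable.refl (hε : 0 < ε) (hδ : 0 < δ) (ν : Measure X) [IsFiniteMeasure ν] :
    AlmostTransportable ε δ ν ν :=
  eventually_pure.1 ((TendstoSetwise.const ν (pure ())).eventually_almostTransportable
    (Eventually.of_forall fun _ => le_rfl) hε hδ)

end Closeness

/-- The limiting form of `AlmostTransportable`: transport over distances at most `c`, up to
arbitrarily small errors in the distance and in the discarded mass. -/
def LimitTransportable {X : Type*} [PseudoEMetricSpace X] [MeasurableSpace X] (c : ℝ≥0∞)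
    (ν η : Measure X) : Prop :=
  ∀ ⦃e : ℝ≥0∞⦄, 0 < e → AlmostTransportable (c + e) e ν η

namespace LimitTransportable

variable {X : Type*} [MeasurableSpace X] {c : ℝ≥0∞}

theorem symm [PseudoEMetricSpace X] {ν η : Measure X} (h : LimitTransportable c ν η) :
    LimitTransportable c η ν :=
  fun _ he => (h he).symm

theorem measure_univ_eq [PseudoEMetricSpace X] {ν η : Measure X} (h : LimitTransportable c ν η) :
    ν univ = η univ :=
  le_antisymm (le_of_forall_pos_le_add fun _ he => (h he).measure_univ_le)
    (le_of_forall_pos_le_add fun _ he => (h.symm he).measure_univ_le)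

theorem of_tendstoSetwise [PseudoMetricSpace X] [OpensMeasurableSpace X]
    [SecondCountableTopology X] {K : Type*} {l : Filter K} [NeBot l] {ν η : K → Measure X}
    {α β κ κ' : Measure X} [IsFiniteMeasure κ] [IsFiniteMeasure κ'] (hα : TendstoSetwise ν l α)
    (hβ : TendstoSetwise η l β) (hν : ∀ᶠ k in l, ν k ≤ κ) (hη : ∀ᶠ k in l, η k ≤ κ')
    (h : ∀ e : ℝ≥0∞, 0 < e → ∀ᶠ k in l, AlmostTransportable (c + e) e (ν k) (η k)) :
    LimitTransportable c α β := by
  intro e he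
  have he3 : 0 < e / 3 := ENNReal.div_pos he.ne' (by finiteness)
  obtain ⟨k, hνk, hηk, hαk, hk, hβk⟩ := (hν.and <| hη.and <|
    (hα.eventually_almostTransportable hν he3 he3).and <| (h (e / 3) he3).and <|
    hβ.eventually_almostTransportable hη he3 he3).exists
  have := isFiniteMeasure_of_le κ hνk
  have := isFiniteMeasure_of_le κ' hηk
  refine ((hαk.trans hk).trans hβk.symm).mono (le_of_eq ?_) (ENNReal.add_thirds e).le
  rw [add_left_comm, add_assoc, ENNReal.add_thirds]

end LimitTransportable

section Splitting

/-- `σ` splits the family `u` of measures at the times in `F`, extending the splitting `γ` of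
`u t`: at each time in `F` the parts sum to `u`, and each part moves by the distance of the times,
up to an error `e`. -/
structure IsApproxSplitting {X T I : Type*} [PseudoEMetricSpace X] [MeasurableSpace X]
    [PseudoEMetricSpace T] (e : ℝ≥0∞) (F : Set T) (u : T → Measure X) (t : T) (γ : I → Measure X)
    (σ : T → I → Measure X) : Prop where
  map_base : σ t = γ
  sum_eq : ∀ s ∈ F, u s = Measure.sum (σ s)
  almostTransportable : ∀ s ∈ F, ∀ s' ∈ F, ∀ i,
    AlmostTransportable (edist s s' + e) e (σ s i) (σ s' i)

variable {X T I : Type*} [PseudoMetricSpace X] [MeasurableSpace X] [OpensMeasurableSpace X]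
  [PseudoEMetricSpace T] {e : ℝ≥0∞} {F : Set T} {u : T → Measure X} [∀ s, IsFiniteMeasure (u s)]
  {t : T} {γ : I → Measure X} {σ : T → I → Measure X}

namespace IsApproxSplitting

theorem singleton [TopologicalSpace.SeparableSpace X] (hγ : u t = Measure.sum γ) (he : 0 < e) :
    IsApproxSplitting e {t} u t γ fun _ => γ where
  map_base := rfl
  sum_eq s hs := by rwa [mem_singleton_iff.1 hs]
  almostTransportable _ _ _ _ i := by
    have : IsFiniteMeasure (γ i) := isFiniteMeasure_of_le (u t) (hγ ▸ Measure.le_sum γ i)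
    exact .refl (he.trans_le le_add_self) he _

/-- Since `m` lies between `a` and every point of `F`, passing through `m` costs no distance, so
only the errors add up. -/
theorem exists_insert [SecondCountableTopology X] [Countable I] [Nonempty I] (he : 0 < e)
    (h : IsApproxSplitting (e / 2) F u t γ σ) (ht : t ∈ F) {a m : T} (ha : a ∉ F) (hm : m ∈ F)
    (hbetween : ∀ s ∈ F, edist s a = edist s m + edist m a)
    (hu : LimitTransportable (edist m a) (u m) (u a)) :
    ∃ σ', IsApproxSplitting e (insert a F) u t γ σ' := by
  classical
  obtain ⟨γ', hγ', hmove⟩ := (hu (ENNReal.half_pos he.ne')).exists_split (h.sum_eq m hm)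
  have hto : ∀ s ∈ F, ∀ i, AlmostTransportable (edist s a + e) e (σ s i) (γ' i) := fun s hs i => by
    have : IsFiniteMeasure (σ m i) :=
      isFiniteMeasure_of_le (u m) (h.sum_eq m hm ▸ Measure.le_sum _ i)
    refine ((h.almostTransportable s hs m hm i).trans (hmove i)).mono (le_of_eq ?_)
      (ENNReal.add_halves e).le
    rw [add_add_add_comm, ENNReal.add_halves, hbetween s hs]
  have hσ : ∀ s ∈ F, Function.update σ a γ' s = σ s := fun s hs =>
    Function.update_of_ne (ne_of_mem_of_not_mem hs ha) _ _
  have hσa : Function.update σ a γ' a = γ' := Function.update_self _ _ _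
  refine ⟨Function.update σ a γ', (hσ t ht).trans h.map_base, ?_, ?_⟩
  · rintro s (rfl | hs)
    · rwa [hσa]
    · rw [hσ s hs, h.sum_eq s hs]
  · rintro s (rfl | hs) s' (rfl | hs') i
    · have : IsFiniteMeasure (γ' i) := isFiniteMeasure_of_le (u s') (hγ' ▸ Measure.le_sum _ i)
      rw [hσa]
      exact .refl (he.trans_le le_add_self) he _
    · rw [hσa, hσ s' hs', edist_comm]
      exact (hto s' hs' i).symm
    · rw [hσa, hσ s hs]
      exact hto s hs i
    · rw [hσ s hs, hσ s' hs']
      exact (h.almostTransportable s hs s' hs' i).mono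
        (add_le_add_right ENNReal.half_le_self _) ENNReal.half_le_self

theorem exists_limit [SecondCountableTopology X] {K : Type*} (U : Ultrafilter K) {e : K → ℝ≥0∞}
    {F : K → Set T} {τ : K → T → I → Measure X}
    (h : ∀ k, IsApproxSplitting (e k) (F k) u t γ (τ k)) (he : Tendsto e U (𝓝 0))
    (hF : ∀ s, ∀ᶠ k in (U : Filter K), s ∈ F k) :
    ∃ σ : T → I → Measure X, σ t = γ ∧ (∀ s, Measure.sum (σ s) ≤ u s) ∧
      ∀ s s' i, LimitTransportable (edist s s') (σ s i) (σ s' i) := by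
  have hle : ∀ s i, ∀ᶠ k in (U : Filter K), τ k s i ≤ u s := fun s i =>
    (hF s).mono fun k hk => (h k).sum_eq s hk ▸ Measure.le_sum _ i
  choose σ hσ using fun s i => exists_tendstoSetwise U (hle s i)
  refine ⟨σ, funext fun i => ?_, fun s => ?_, fun s s' i => ?_⟩
  · refine (hσ t i).unique ?_
    simp only [(h _).map_base]
    exact TendstoSetwise.const (γ i) _
  · exact sum_le_of_tendstoSetwise (hσ s) ((hF s).mono fun k hk => ((h k).sum_eq s hk).ge)
  · refine .of_tendstoSetwise (hσ s i) (hσ s' i) (hle s i) (hle s' i) fun δ hδ => ?_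
    filter_upwards [hF s, hF s', he.eventually_le_const hδ] with k hs hs' hk
    exact ((h k).almostTransportable s hs s' hs' i).mono (add_le_add_right hk _) hk

end IsApproxSplitting

end Splitting

section RealTimes

theorem edist_eq_edist_add_edist_of_le_of_le {x y z : ℝ} (hxy : x ≤ y) (hyz : y ≤ z) :
    edist x z = edist x y + edist y z := by
  simp only [edist_dist, Real.dist_eq, abs_sub_comm x, abs_sub_comm y z]
  rw [abs_of_nonneg (sub_nonneg.2 hxy), abs_of_nonneg (sub_nonneg.2 hyz),
    abs_of_nonneg (sub_nonneg.2 (hxy.trans hyz)),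
    ← ENNReal.ofReal_add (sub_nonneg.2 hxy) (sub_nonneg.2 hyz), sub_add_sub_cancel']

theorem exists_between_of_farthest {S : Set ℝ} {t a : S} {F : Finset S} (ht : t ∈ F)
    (hfar : ∀ s ∈ F, dist s t ≤ dist a t) :
    ∃ m ∈ F, ∀ s ∈ F, edist s a = edist s m + edist m a := by
  have hF : F.Nonempty := ⟨t, ht⟩
  have habs : ∀ s ∈ F, |(s : ℝ) - t| ≤ |(a : ℝ) - t| := hfar
  rcases le_total (a : ℝ) t with hat | hta
  · have ha : |(a : ℝ) - t| = t - a := by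
      rw [abs_sub_comm, abs_of_nonneg (sub_nonneg.2 hat)]
    refine ⟨F.min' hF, F.min'_mem hF, fun s hs => ?_⟩
    rw [edist_comm s a, edist_comm s, add_comm, edist_comm _ a]
    refine edist_eq_edist_add_edist_of_le_of_le ?_ (F.min'_le s hs)
    linarith [neg_abs_le ((F.min' hF : ℝ) - t), habs _ (F.min'_mem hF)]
  · have ha : |(a : ℝ) - t| = a - t := abs_of_nonneg (sub_nonneg.2 hta)
    refine ⟨F.max' hF, F.max'_mem hF, fun s hs =>
      edist_eq_edist_add_edist_of_le_of_le (F.le_max' s hs) ?_⟩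
    linarith [le_abs_self ((F.max' hF : ℝ) - t), habs _ (F.max'_mem hF)]

variable {X I : Type*} [PseudoMetricSpace X] [MeasurableSpace X] [OpensMeasurableSpace X]
  [SecondCountableTopology X] [Countable I] {S : Set ℝ} {u : S → Measure X}
  [∀ s, IsFiniteMeasure (u s)] {t : S} {γ : I → Measure X}

theorem exists_isApproxSplitting [Nonempty I]
    (hu : ∀ s s', LimitTransportable (edist s s') (u s) (u s')) (hγ : u t = Measure.sum γ)
    (F : Finset S) : ∀ e : ℝ≥0∞, 0 < e → ∃ σ, IsApproxSplitting e (insert t F) u t γ σ := by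
  induction F using Finset.induction_on_max_value fun s => dist s t with
  | empty =>
    intro e he
    refine ⟨fun _ => γ, ?_⟩
    simpa only [Finset.coe_empty, insert_empty_eq] using IsApproxSplitting.singleton hγ he
  | insert a F haF hfar ih =>
    intro e he
    rw [Finset.coe_insert, insert_comm]
    rcases eq_or_ne a t with rfl | hat
    · simpa only [insert_idem] using ih e he
    obtain ⟨m, hm, hbetween⟩ := exists_between_of_farthest (a := a) (Finset.mem_insert_self t F)
      (Finset.forall_mem_insert _ _ _ |>.2 ⟨by simp, hfar⟩)
    obtain ⟨σ, hσ⟩ := ih (e / 2) (ENNReal.half_pos he.ne')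
    rw [← Finset.coe_insert] at hσ ⊢
    exact hσ.exists_insert he (Finset.mem_coe.2 (Finset.mem_insert_self t F))
      (by simp [hat, haF]) hm hbetween (hu m a)

theorem exists_limitTransportable_splitting
    (hu : ∀ s s', LimitTransportable (edist s s') (u s) (u s')) (hγ : u t = Measure.sum γ) :
    ∃ σ : S → I → Measure X, σ t = γ ∧ (∀ s, u s = Measure.sum (σ s)) ∧
      ∀ s s' i, LimitTransportable (edist s s') (σ s i) (σ s' i) := by
  rcases isEmpty_or_nonempty I with hI | hI
  · refine ⟨fun _ => γ, rfl, fun s => ?_, fun _ _ => isEmptyElim⟩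
    rw [Measure.sum_of_isEmpty] at hγ ⊢
    rw [← Measure.measure_univ_eq_zero, (hu s t).measure_univ_eq, hγ, Measure.coe_zero,
      Pi.zero_apply]
  choose τ hτ using fun k : Finset S × ℕ => exists_isApproxSplitting hu hγ k.1 (k.2 : ℝ≥0∞)⁻¹
    (ENNReal.inv_pos.2 (ENNReal.natCast_ne_top k.2))
  have herror : Tendsto (fun k : Finset S × ℕ => (k.2 : ℝ≥0∞)⁻¹) atTop (𝓝 0) := by
    rw [← prod_atTop_atTop_eq]
    exact ENNReal.tendsto_inv_nat_nhds_zero.comp tendsto_snd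
  have hexhaust : ∀ s : S, ∀ᶠ k : Finset S × ℕ in atTop, s ∈ insert t (k.1 : Set S) := fun s =>
    (eventually_ge_atTop (({s}, 0) : Finset S × ℕ)).mono fun k hk =>
      mem_insert_of_mem t (hk.1 (Finset.mem_singleton_self s))
  obtain ⟨σ, rfl, hle, hσ⟩ := IsApproxSplitting.exists_limit (Ultrafilter.of atTop) hτ
    (herror.mono_left (Ultrafilter.of_le atTop)) fun s => Ultrafilter.of_le atTop (hexhaust s)
  refine ⟨σ, rfl, fun s => ?_, hσ⟩
  have : IsFiniteMeasure (Measure.sum (σ s)) := isFiniteMeasure_of_le _ (hle s)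
  refine (Measure.eq_of_le_of_measure_univ_eq (hle s) ?_).symm
  rw [(hu s t).measure_univ_eq, hγ, Measure.sum_apply _ MeasurableSet.univ,
    Measure.sum_apply _ MeasurableSet.univ]
  exact tsum_congr fun i => (hσ s t i).measure_univ_eq

end RealTimes

theorem AlmostTransportable.exists_decomposition {X : Type*} [PseudoMetricSpace X]
    [MeasurableSpace X] [OpensMeasurableSpace X] [TopologicalSpace.SeparableSpace X] {ε δ : ℝ≥0∞}
    {ν η : Measure X} (h : AlmostTransportable ε δ ν η) (hε : 0 < ε) :
    ∃ (J : Type) (_ : Countable J) (νs ηs : J → Measure X), ν = Measure.sum νs ∧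
      η = Measure.sum ηs ∧ (∀ j, Metric.ediam ((νs j).support ∪ (ηs j).support) ≤ ε) ∧
      ∑' j, ((νs j univ - ηs j univ) + (ηs j univ - νs j univ)) ≤ δ := by
  obtain ⟨_, ν', _, η', rfl, rfl, ⟨J, hJ, νs, ηs, rfl, rfl, hmass, hdiam⟩, hdefect⟩ := h
  obtain ⟨A, hA, hA_diam, hcover, hdisj⟩ := exists_measurable_partition_ediam_closure_le X hε
  refine ⟨J ⊕ ℕ, inferInstance, Sum.elim νs fun n => ν'.restrict (A n),
    Sum.elim ηs fun n => η'.restrict (A n), ?_, ?_, ?_, ?_⟩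
  · rw [sum_sumElim, sum_restrict_partition hA hcover hdisj]
  · rw [sum_sumElim, sum_restrict_partition hA hcover hdisj]
  · rintro (j | n)
    · exact hdiam j
    · exact ediam_support_restrict_union_le (hA_diam n) ν' η'
  · rw [Summable.tsum_sum ENNReal.summable ENNReal.summable]
    simp only [Sum.elim_inl, Sum.elim_inr, hmass, tsub_self, add_zero, tsum_zero, zero_add,
      Measure.restrict_apply_univ]
    calc ∑' n, ((ν' (A n) - η' (A n)) + (η' (A n) - ν' (A n)))
        ≤ ∑' n, (ν' (A n) + η' (A n)) :=
          ENNReal.tsum_le_tsum fun n => add_le_add tsub_le_self tsub_le_self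
      _ = ν' univ + η' univ := by
          rw [ENNReal.tsum_add, ← measure_iUnion hdisj hA, ← measure_iUnion hdisj hA, hcover]
      _ ≤ δ := hdefect

section Dominated

theorem ofReal_abs_toReal_sub {a b : ℝ≥0∞} (ha : a ≠ ∞) (hb : b ≠ ∞) :
    ENNReal.ofReal |a.toReal - b.toReal| = (a - b) + (b - a) := by
  rcases le_total a b with hab | hab
  · rw [abs_sub_comm, ← ENNReal.toReal_sub_of_le hab hb, abs_of_nonneg ENNReal.toReal_nonneg,
      ENNReal.ofReal_toReal (ENNReal.sub_ne_top hb), tsub_eq_zero_of_le hab, zero_add]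
  · rw [← ENNReal.toReal_sub_of_le hab ha, abs_of_nonneg ENNReal.toReal_nonneg,
      ENNReal.ofReal_toReal (ENNReal.sub_ne_top ha), tsub_eq_zero_of_le hab, add_zero]

theorem ofReal_abs_mass_sub {X : Type*} [MeasurableSpace X] (ν η : Measure X)
    [IsFiniteMeasure ν] [IsFiniteMeasure η] :
    ENNReal.ofReal |mass ν - mass η| = (ν univ - η univ) + (η univ - ν univ) :=
  ofReal_abs_toReal_sub (measure_ne_top ν univ) (measure_ne_top η univ)

variable {X : Type*} [MetricSpace X] [MeasurableSpace X] {μ : Measure X}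

theorem mem_dominated_of_le {ν κ : Measure X} (hκ : κ ∈ dominated μ) (hνκ : ν ≤ κ) :
    ν ∈ dominated μ := by
  have := hκ.1.1
  exact ⟨⟨isFiniteMeasure_of_le κ hνκ,
    hκ.1.2.of_isClosed_subset Measure.isClosed_support (Measure.support_mono hνκ)⟩,
    hνκ.trans hκ.2⟩

instance isFiniteMeasure_dominated (ν : dominated μ) : IsFiniteMeasure (ν : Measure X) :=
  ν.2.1.1

theorem HasDecomp.almostTransportable {ε δ : ℝ≥0} {ν η : dominated μ}
    (h : HasDecomp μ ε δ ν η) : AlmostTransportable ε δ (ν : Measure X) η := by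
  obtain ⟨J, hJ, νs, ηs, hdecomp⟩ := h
  rw [hdecomp.sum_left, hdecomp.sum_right]
  refine .of_sum hdecomp.diam_le ?_
  simpa only [ofReal_abs_mass_sub] using hdecomp.mass_le

theorem AlmostTransportable.hasDecomp [OpensMeasurableSpace X] [TopologicalSpace.SeparableSpace X]
    {ε δ : ℝ≥0} {ν η : dominated μ} (h : AlmostTransportable ε δ (ν : Measure X) η) (hε : 0 < ε) :
    HasDecomp μ ε δ ν η := by
  obtain ⟨J, hJ, νs, ηs, hν, hη, hdiam, hdefect⟩ :=
    h.exists_decomposition (ENNReal.coe_pos.2 hε)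
  have hνs : ∀ j, νs j ∈ dominated μ := fun j =>
    mem_dominated_of_le ν.2 (hν ▸ Measure.le_sum νs j)
  have hηs : ∀ j, ηs j ∈ dominated μ := fun j =>
    mem_dominated_of_le η.2 (hη ▸ Measure.le_sum ηs j)
  have : ∀ j, IsFiniteMeasure (νs j) := fun j => (hνs j).1.1
  have : ∀ j, IsFiniteMeasure (ηs j) := fun j => (hηs j).1.1
  refine ⟨J, hJ, fun j => ⟨νs j, hνs j⟩, fun j => ⟨ηs j, hηs j⟩, hν, hη, ?_, hdiam⟩
  simpa only [ofReal_abs_mass_sub] using hdefect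

variable {h : ℝ≥0 → ℝ≥0} {ν η : dominated μ}

theorem almostTransportable_of_dominatedDist_lt (hmono : Monotone h) {ε : ℝ≥0}
    (hdist : dominatedDist μ h ν η < ε) : AlmostTransportable ε (h ε) (ν : Measure X) η := by
  simp only [dominatedDist, iInf_lt_iff] at hdist
  obtain ⟨ε', ⟨-, hdecomp⟩, hlt⟩ := hdist
  exact hdecomp.almostTransportable.mono hlt.le
    (ENNReal.coe_le_coe.2 (hmono (ENNReal.coe_le_coe.1 hlt.le)))

theorem dominatedDist_le_of_limitTransportable [OpensMeasurableSpace X]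
    [TopologicalSpace.SeparableSpace X] (hmono : Monotone h) (hpos : ∀ ε, 0 < ε → 0 < h ε)
    {c : ℝ≥0∞} (hc : LimitTransportable c (ν : Measure X) η) : dominatedDist μ h ν η ≤ c := by
  refine ENNReal.le_of_forall_pos_le_add fun e he hc_top => ?_
  lift c to ℝ≥0 using hc_top.ne
  have hdecomp : HasDecomp μ (c + e) (h (c + e)) ν η := by
    have herror : 0 < min e (h e) := lt_min he (hpos e he)
    refine ((hc (ENNReal.coe_pos.2 herror)).mono ?_ ?_).hasDecomp (he.trans_le le_add_self)
    · exact_mod_cast add_le_add_right (min_le_left e (h e)) c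
    · exact_mod_cast (min_le_right e (h e)).trans (hmono le_add_self)
  exact iInf₂_le_of_le (c + e) ⟨he.trans_le le_add_self, hdecomp⟩ (ENNReal.coe_add c e).le

theorem exists_nat_mul_gauge_div_le
    (hdiv : Tendsto (fun ε => h ε / ε) (𝓝[>] 0) (𝓝 0)) {c e : ℝ≥0} (hc : 0 < c) (he : 0 < e) :
    ∃ n : ℕ, (n + 1) * h (c / (n + 1)) ≤ e := by
  have hmesh : Tendsto (fun n : ℕ => c / ((n : ℝ≥0) + 1)) atTop (𝓝[>] 0) := by
    refine tendsto_nhdsWithin_iff.2 ⟨?_, Eventually.of_forall fun n => div_pos hc (by positivity)⟩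
    simpa only [mul_zero, mul_one_div] using
      (tendsto_one_div_add_atTop_nhds_zero_nat (𝕜 := ℝ≥0)).const_mul c
  obtain ⟨n, hn⟩ := ((hdiv.comp hmesh).eventually_le_const (div_pos he hc)).exists
  refine ⟨n, ?_⟩
  calc (n + 1) * h (c / (n + 1)) = c * (h (c / (n + 1)) / (c / (n + 1))) := by field_simp
    _ ≤ c * (e / c) := mul_le_mul_right hn c
    _ = e := mul_div_cancel₀ e hc.ne'

end Dominated

section Curves

theorem IsSubparamCurve.of_lipschitz {Y : Type*} {d : Y → Y → ℝ≥0∞} {a b : ℝ} {γ : Icc a b → Y}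
    (hγ : ∀ s t : Icc a b, s ≤ t → d (γ t) (γ s) ≤ ENNReal.ofReal ((t : ℝ) - s)) :
    IsSubparamCurve d γ := by
  refine ⟨(iSup₂_le fun k u => ?_ : _ ≤ ENNReal.ofReal (b - a)).trans_lt ENNReal.ofReal_lt_top, hγ⟩
  have hu : ∀ i, u.1 i ≤ u.1 (i + 1) := fun i => u.2 i.le_succ
  calc ∑ i ∈ Finset.range (k + 1), d (γ (u.1 (i + 1))) (γ (u.1 i))
      ≤ ∑ i ∈ Finset.range (k + 1), ENNReal.ofReal ((u.1 (i + 1) : ℝ) - u.1 i) :=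
        Finset.sum_le_sum fun i _ => hγ _ _ (hu i)
    _ = ENNReal.ofReal ((u.1 (k + 1) : ℝ) - u.1 0) := by
        rw [← ENNReal.ofReal_sum_of_nonneg fun i _ => sub_nonneg.2 (hu i),
          Finset.sum_range_sub fun i => (u.1 i : ℝ)]
    _ ≤ ENNReal.ofReal (b - a) :=
        ENNReal.ofReal_le_ofReal (sub_le_sub (u.1 _).2.2 (u.1 _).2.1)

theorem edist_eq_ofReal_sub_of_le {S : Set ℝ} {s t : S} (hst : s ≤ t) :
    edist t s = ENNReal.ofReal ((t : ℝ) - s) := by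
  rw [Subtype.edist_eq, edist_dist, Real.dist_eq,
    abs_of_nonneg (sub_nonneg.2 (Subtype.coe_le_coe.2 hst))]

theorem IsSubparamCurve.apply_projIcc_le {Y : Type*} {d : Y → Y → ℝ≥0∞} {a b : ℝ}
    {γ : Icc a b → Y} (hγ : IsSubparamCurve d γ) (hab : a ≤ b) {x y : ℝ} (hxy : x ≤ y) :
    d (γ (projIcc a b hab y)) (γ (projIcc a b hab x)) ≤ ENNReal.ofReal (y - x) := by
  have hproj := monotone_projIcc hab hxy
  calc d (γ (projIcc a b hab y)) (γ (projIcc a b hab x))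
      ≤ edist (projIcc a b hab y) (projIcc a b hab x) :=
        (hγ.lipschitz _ _ hproj).trans_eq (edist_eq_ofReal_sub_of_le hproj).symm
    _ ≤ edist y x := by simpa only [ENNReal.coe_one, one_mul] using LipschitzWith.projIcc hab y x
    _ = ENNReal.ofReal (y - x) := by
        rw [edist_dist, Real.dist_eq, abs_of_nonneg (sub_nonneg.2 hxy)]

variable {X : Type*} [MetricSpace X] [MeasurableSpace X] {μ : Measure X} {h : ℝ≥0 → ℝ≥0} {a b : ℝ}
  {η : Icc a b → dominated μ}

theorem IsSubparamCurve.almostTransportable_of_sub_lt [HereditarilyLindelofSpace X]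
    (hη : IsSubparamCurve (dominatedDist μ h) η) (hmono : Monotone h) {s s' : Icc a b} (hs : s ≤ s')
    {n : ℕ} {ε : ℝ≥0} (hε : (s' - s : ℝ) < (n + 1) * ε) :
    AlmostTransportable ((n + 1) * ε) ((n + 1) * h ε) (η s' : Measure X) (η s) := by
  have hab : a ≤ b := s.2.1.trans s.2.2
  set mesh : ℝ := (s' - s) / (n + 1)
  have hmesh : 0 ≤ mesh := div_nonneg (sub_nonneg.2 hs) (by positivity)
  have hmesh_lt : mesh < ε := by rwa [div_lt_iff₀' (by positivity)]
  let time (k : ℕ) : Icc a b := projIcc a b hab (s + k * mesh)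
  have htime_zero : time 0 = s := by
    simp only [time, Nat.cast_zero, zero_mul, add_zero, projIcc_val]
  have htime_end : time (n + 1) = s' := by
    have hend : (s : ℝ) + (n + 1 : ℕ) * mesh = s' := by
      push_cast
      rw [mul_div_cancel₀ _ (by positivity), add_sub_cancel]
    simp only [time, hend, projIcc_val]
  have hstep (k : ℕ) : AlmostTransportable ε (h ε) (η (time k) : Measure X) (η (time (k + 1))) := by
    refine (almostTransportable_of_dominatedDist_lt hmono ?_).symm
    calc dominatedDist μ h (η (time (k + 1))) (η (time k))
        ≤ ENNReal.ofReal (s + (k + 1 : ℕ) * mesh - (s + k * mesh)) :=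
          hη.apply_projIcc_le hab (by push_cast; linarith)
      _ = ENNReal.ofReal mesh := by
          push_cast
          ring_nf
      _ < ε := by rwa [ENNReal.ofReal_lt_coe_iff hmesh]
  simpa only [htime_zero, htime_end] using (AlmostTransportable.chain hstep n).symm

theorem IsSubparamCurve.limitTransportable [HereditarilyLindelofSpace X]
    (hη : IsSubparamCurve (dominatedDist μ h) η) (hmono : Monotone h)
    (hdiv : Tendsto (fun ε => h ε / ε) (𝓝[>] 0) (𝓝 0)) (s s' : Icc a b) :
    LimitTransportable (edist s s') (η s : Measure X) (η s') := by
  wlog hs : s' ≤ s generalizing s s'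
  · rw [edist_comm]
    exact (this s' s (le_of_not_ge hs)).symm
  intro e he
  obtain ⟨r, hr, hre⟩ := ENNReal.lt_iff_exists_nnreal_btwn.1 he
  rw [ENNReal.coe_pos] at hr
  let c : ℝ≥0 := nndist s s' + r
  obtain ⟨n, hn⟩ := exists_nat_mul_gauge_div_le hdiv (c := c) (hr.trans_le le_add_self) hr
  have hn_pos : (0 : ℝ≥0) < n + 1 := by positivity
  have hsteps : (n + 1) * (c / (n + 1)) = c := mul_div_cancel₀ c hn_pos.ne'
  have hsub : (s - s' : ℝ) < (n + 1) * (c / (n + 1) : ℝ≥0) := by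
    calc (s - s' : ℝ) = nndist s s' :=
          (abs_of_nonneg (sub_nonneg.2 (Subtype.coe_le_coe.2 hs))).symm
      _ < nndist s s' + r := lt_add_of_pos_right _ hr
      _ = (n + 1) * (c / (n + 1) : ℝ≥0) := by exact_mod_cast hsteps.symm
  refine (hη.almostTransportable_of_sub_lt hmono hs hsub).mono ?_ (le_trans ?_ hre.le)
  · calc ((n + 1) * (c / (n + 1) : ℝ≥0) : ℝ≥0∞) = edist s s' + r := by
          rw [edist_nndist]
          exact_mod_cast hsteps
      _ ≤ edist s s' + e := add_le_add_right hre.le _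
  · exact_mod_cast hn

end Curves

end SubMeas

theorem mainTheorem8_general {X : Type*} [MetricSpace X] [TopologicalSpace.SeparableSpace X]
    [MeasurableSpace X] [OpensMeasurableSpace X] (μ : Measure X) (h : ℝ≥0 → ℝ≥0)
    (hmono : Monotone h) (hpos : ∀ ε, 0 < ε → 0 < h ε)
    (hdiv : Tendsto (fun ε => h ε / ε) (𝓝[>] 0) (𝓝 0)) {M : Type*} [Countable M] {a b : ℝ}
    (η : Icc a b → SubMeas.dominated μ)
    (hη : SubMeas.IsSubparamCurve (SubMeas.dominatedDist μ h) η) (t : Icc a b)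
    (γ : M → SubMeas.dominated μ)
    (hγ : (η t : Measure X) = Measure.sum fun i => (γ i : Measure X)) :
    ∃ ηs : M → Icc a b → SubMeas.dominated μ,
      (∀ i, SubMeas.IsSubparamCurve (SubMeas.dominatedDist μ h) (ηs i)) ∧
      (∀ i, ηs i t = γ i) ∧
      ∀ s : Icc a b, (η s : Measure X) = Measure.sum fun i => (ηs i s : Measure X) := by
  have : SecondCountableTopology X := UniformSpace.secondCountable_of_separable X
  obtain ⟨σ, hσt, hσ_sum, hσ⟩ := SubMeas.exists_limitTransportable_splitting
    (u := fun s => (η s : Measure X)) (hη.limitTransportable hmono hdiv) hγ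
  have hσ_mem : ∀ i s, σ s i ∈ SubMeas.dominated μ := fun i s =>
    SubMeas.mem_dominated_of_le (η s).2 (hσ_sum s ▸ Measure.le_sum (σ s) i)
  refine ⟨fun i s => ⟨σ s i, hσ_mem i s⟩, fun i => .of_lipschitz fun s s' hs => ?_,
    fun i => Subtype.ext (congrFun hσt i), hσ_sum⟩
  rw [← SubMeas.edist_eq_ofReal_sub_of_le hs]
  exact SubMeas.dominatedDist_le_of_limitTransportable hmono hpos (hσ s' s i)

theorem mainTheorem8 {X : Type*} [MetricSpace X] [LocallyCompactSpace X]
    [TopologicalSpace.SeparableSpace X] [MeasurableSpace X] [BorelSpace X]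
    (μ : Measure X)
    (hμ : ∀ (x : X) (r : ℝ), 0 < r → 0 < μ (Metric.ball x r) ∧ μ (Metric.ball x r) < ∞)
    (h : ℝ≥0 → ℝ≥0) (hh : SubMeas.IsGauge h)
    {M : Type*} [Countable M]
    (b : ℝ) (hb : 0 ≤ b)
    (η : Icc (0 : ℝ) b → SubMeas.dominated μ)
    (hη : SubMeas.IsSubparamCurve (SubMeas.dominatedDist μ h) η)
    (t : Icc (0 : ℝ) b)
    (γ : M → SubMeas.dominated μ)
    (hγ : (η t : Measure X) = Measure.sum fun i => (γ i : Measure X)) :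
    ∃ ηs : M → Icc (0 : ℝ) b → SubMeas.dominated μ,
      (∀ i, SubMeas.IsSubparamCurve (SubMeas.dominatedDist μ h) (ηs i)) ∧
      (∀ i, ηs i t = γ i) ∧
      ∀ s : Icc (0 : ℝ) b, (η s : Measure X) = Measure.sum fun i => (ηs i s : Measure X) := by
  exact mainTheorem8_general μ h hh.strictMono.monotone
    (fun _ hε => hh.map_zero ▸ hh.strictMono hε) hh.tendsto_div η hη t γ hγ
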